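/- Let $C=\{(x,y,z)\in\mathbb{R}^3 : x\le -\sqrt{y^2+z^2}\}$, let $C^\circ=\{y\in\mathbb{R}^3:\langle x,y\rangle\le 0 \text{ for all } x\in C\}$, and let $\Omega=\operatorname{int}C^\circ\cap S^2$. For $\alpha>0$ put $\omega_\alpha=\{v\in\Omega : \delta_{\partial\Omega}(v)>\alpha\}$, where $\partial\Omega$ is the boundary of $\Omega$ in $S^2$ and $\delta_{\partial\Omega}$ is the spherical distance to it. For $m>0$ and a Borel measure $\mu$ on $\Omega$ let $$J_m(\mu)=\int_0^{\pi/2}\mu(\omega_\alpha)^{1/m}\,d\alpha\in[0,\infty].$$ A nonempty closed convex set $K\subset\mathbb{R}^3$ is called $C$-asymptotic if $\lambda x\in K$ for all $x\in K$ and $\lambda\ge 1$, if its recession cone $\{y : x+\lambda y\in K \text{ for all } x\in K,\ \lambda\ge 1\}$ equals $C$, and if $\operatorname{dist}(x,\partial C)\to 0$ as $|x|\to\infty$ with $x\in\partial K$. Its surface area measure is $S_K(\eta)=\mathcal{H}^2(\{x\in\partial K : \langle x,v\rangle=h_K(v)\text{ for some }v\in\eta\})$ for Borel sets $\eta\subset\Omega$,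 where $h_K(v)=\sup_{x\in K}\langle x,v\rangle$. Let $0<m<2$. Then there exists a $C$-asymptotic set $K$ with $J_m(S_K)=\infty$. Hence, although $J_m(\mu)<\infty$ implies $J_2(\mu)<\infty$ for every Borel measure $\mu$ on $\Omega$ (so that $J_m<\infty$ is a stronger condition than $J_2<\infty$), it is not true that $J_m(S_K)<\infty$ for every $C$-asymptotic set $K$. -/

import Mathlib

open scoped ENNReal Topology

namespace PseudoCone

noncomputable section

/-- Three-dimensional Euclidean space `ℝ³`. -/
abbrev E3 : Type := EuclideanSpace ℝ (Fin 3)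

/-- The polar (dual) cone `C° = {y : ⟨x, y⟩ ≤ 0 for all x ∈ C}`. -/
def polarCone (C : Set E3) : Set E3 :=
  {y | ∀ x ∈ C, inner ℝ x y ≤ 0}

/-- `Ω = int C° ∩ S²`, an open subset of the unit sphere. -/
def Omega (C : Set E3) : Set E3 :=
  interior (polarCone C) ∩ Metric.sphere 0 1

/-- `∂Ω`, the boundary of `Ω` relative to the unit sphere `S²`: the points that are both in the
closure of `Ω` and in the closure of `S² \ Ω`. -/
def bdryOmega (C : Set E3) : Set E3 :=
  closure (Omega C) ∩ closure (Metric.sphere 0 1 \ Omega C)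

/-- `δ_{∂Ω}(v)`, the spherical (geodesic) distance from a unit vector `v` to `∂Ω`: the spherical
distance of two unit vectors is the angle between them. -/
def sphDist (C : Set E3) (v : E3) : ℝ :=
  sInf ((fun w => InnerProductGeometry.angle v w) '' bdryOmega C)

/-- `ω_α = {v ∈ Ω : δ_{∂Ω}(v) > α}`. -/
def omega (C : Set E3) (α : ℝ) : Set E3 :=
  {v | v ∈ Omega C ∧ α < sphDist C v}

/-- A pseudo cone: a nonempty closed convex set `K` with `λ x ∈ K` for all `x ∈ K`, `λ ≥ 1`. -/
structure IsPseudoCone (K : Set E3) : Prop where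
  nonempty : K.Nonempty
  isClosed : IsClosed K
  convex : Convex ℝ K
  smul_mem : ∀ x ∈ K, ∀ l : ℝ, 1 ≤ l → l • x ∈ K

/-- The recession cone `rec K = {y : x + λ y ∈ K for all x ∈ K, λ ≥ 1}`. -/
def recCone (K : Set E3) : Set E3 :=
  {y | ∀ x ∈ K, ∀ l : ℝ, 1 ≤ l → x + l • y ∈ K}

/-- `K` is a `C`-pseudo set: a pseudo cone whose recession cone is `C`. -/
def IsCPseudo (C K : Set E3) : Prop :=
  IsPseudoCone K ∧ recCone K = C

/-- `K` is a `C`-asymptotic set: a `C`-pseudo set such that `dist(x, ∂C) → 0` for `x ∈ ∂K`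
as `|x| → ∞`. -/
def IsCAsymptotic (C K : Set E3) : Prop :=
  IsCPseudo C K ∧
    ∀ ε : ℝ, 0 < ε → ∃ R : ℝ, ∀ x ∈ frontier K, R < ‖x‖ → Metric.infDist x (frontier C) < ε

/-- The support function `h_K(y) = sup_{x ∈ K} ⟨x, y⟩`. For a `C`-pseudo set `K` and `y ∈ C°` the
supremum is over a nonempty set that is bounded above by `0`, because `K ⊆ C`. -/
def supportFn (K : Set E3) (y : E3) : ℝ :=
  sSup ((fun x => inner ℝ x y) '' K)

/-- The inverse Gauss image `τ_K(η) = {x ∈ ∂K : ⟨x, v⟩ = h_K(v) for some v ∈ η}`. -/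
def invGauss (K : Set E3) (η : Set E3) : Set E3 :=
  {x | x ∈ frontier K ∧ ∃ v ∈ η, inner ℝ x v = supportFn K v}

/-- The surface area measure `S_K(η) = ℋ²(τ_K(η))` of a `C`-pseudo set `K`, for Borel sets
`η ⊆ Ω`, recorded through its values. Here `μHE[2]` is the two-dimensional Hausdorff
measure, normalized so that it is the usual area on planes. -/
def surfaceArea (K : Set E3) (η : Set E3) : ℝ≥0∞ :=
  (MeasureTheory.Measure.euclideanHausdorffMeasure 2 : MeasureTheory.Measure E3) (invGauss K η)

/-- `J_m(μ) = ∫₀^{π/2} μ(ω_α)^{1/m} dα ∈ [0, ∞]` for `m > 0`; only the values of `μ` on subsets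
of `Ω` matter. -/
def J (C : Set E3) (m : ℝ) (μ : Set E3 → ℝ≥0∞) : ℝ≥0∞ :=
  ∫⁻ α in Set.Ioo (0 : ℝ) (Real.pi / 2), μ (omega C α) ^ (1 / m)

/-- The circular cone `{(x, y, z) : x ≤ -√(y² + z²)}`. -/
def circularCone : Set E3 :=
  {p | p 0 ≤ -Real.sqrt (p 1 ^ 2 + p 2 ^ 2)}

end

end PseudoCone

/-! For `F : ℝ² → ℝ` let `K` be the set of points on or below the graph of `-F`. If `F` is convex
and `1`-Lipschitz, and `F w - ‖w‖` is nonnegative and tends to `0` at infinity, then `K` is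
`C`-asymptotic. A subgradient `k` of `F` at `w` makes `(1, k)` an outer normal of `K` at the point
over `w`, and the angle from it to `∂Ω` is at least `(1 - ‖k‖) / 4`; so `S_K(ω_α)` is at least the
area of the set of `w` at which `1 - ‖k‖` exceeds `4 α`. For the radial `F` with
`1 - ‖∇F w‖ = (1 + ‖w‖) ^ (-q)`, where `q = 2 / m > 1`, this set contains a disc of radius a
constant times `α ^ (-1 / q)`, hence `S_K(ω_α) ^ (1 / m)` is at least a constant times `1 / α`,
which is not integrable at `0`. -/

namespace PseudoCone

open Filter MeasureTheory

section Subgradient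

variable {V : Type*} [NormedAddCommGroup V] [InnerProductSpace ℝ V] {F : V → ℝ}

/-- `k` is a subgradient of `F` at `w`: the affine function through `(w, F w)` with gradient `k`
is below `F` everywhere. Subgradients describe the outer normals of the region below `-F`. -/
def IsSubgradientAt (F : V → ℝ) (k w : V) : Prop :=
  ∀ u, F w + inner ℝ k (u - w) ≤ F u

theorem convexOn_univ_of_isSubgradientAt (h : ∀ w, ∃ k, IsSubgradientAt F k w) :
    ConvexOn ℝ Set.univ F := by
  refine ⟨convex_univ, fun x _ y _ a b ha hb hab => ?_⟩
  obtain ⟨k, hk⟩ := h (a • x + b • y)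
  have hbalance :
      a * inner ℝ k (x - (a • x + b • y)) + b * inner ℝ k (y - (a • x + b • y)) = 0 := by
    obtain rfl := eq_sub_of_add_eq hab
    simp only [inner_sub_right, inner_add_right, real_inner_smul_right]
    ring
  calc F (a • x + b • y)
      = a * (F (a • x + b • y) + inner ℝ k (x - (a • x + b • y)))
        + b * (F (a • x + b • y) + inner ℝ k (y - (a • x + b • y))) := by
        linear_combination -hbalance - F (a • x + b • y) * hab
    _ ≤ a • F x + b • F y := by
        simp only [smul_eq_mul]
        gcongr <;> apply hk

theorem lipschitzWith_of_isSubgradientAt {L : NNReal}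
    (h : ∀ w, ∃ k, IsSubgradientAt F k w ∧ ‖k‖ ≤ L) : LipschitzWith L F := by
  refine LipschitzWith.of_le_add_mul L fun w u => ?_
  obtain ⟨k, hk, hkL⟩ := h w
  have hinner : inner ℝ k (w - u) ≤ L * dist w u := by
    rw [dist_eq_norm]
    exact (real_inner_le_norm _ _).trans (by gcongr)
  have hu := hk u
  rw [← neg_sub w u, inner_neg_right] at hu
  linarith

theorem exists_isSubgradientAt_comp_norm {φ : ℝ → ℝ} {s : ℝ} (hs : 0 ≤ s) (w : V)
    (h : ∀ t, 0 ≤ t → φ ‖w‖ + s * (t - ‖w‖) ≤ φ t) :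
    ∃ k, IsSubgradientAt (fun u => φ ‖u‖) k w ∧ ‖k‖ ≤ s := by
  obtain ⟨k, hks, hkw⟩ : ∃ k : V, ‖k‖ ≤ s ∧ inner ℝ k w = s * ‖w‖ := by
    rcases eq_or_ne w 0 with rfl | hw
    · exact ⟨0, by simpa using hs, by simp⟩
    · have hw' : ‖w‖ ≠ 0 := norm_ne_zero_iff.2 hw
      refine ⟨(s / ‖w‖) • w, ?_, ?_⟩
      · rw [norm_smul, Real.norm_of_nonneg (by positivity), div_mul_cancel₀ _ hw']
      · rw [real_inner_smul_left, real_inner_self_eq_norm_sq]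
        field_simp
  refine ⟨k, fun u => ?_, hks⟩
  calc φ ‖w‖ + inner ℝ k (u - w)
      ≤ φ ‖w‖ + s * (‖u‖ - ‖w‖) := by
        rw [inner_sub_right, hkw, mul_sub]
        gcongr
        exact (real_inner_le_norm k u).trans (by gcongr)
    _ ≤ φ ‖u‖ := h _ (norm_nonneg u)

end Subgradient

noncomputable section

section Coordinates

/-- The Euclidean plane `ℝ²`, in which the last two coordinates of a point of `ℝ³` live. -/
abbrev E2 : Type := EuclideanSpace ℝ (Fin 2)

/-- The projection `(x, y, z) ↦ (y, z)` along the axis of the circular cone. -/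
def tail : E3 →L[ℝ] E2 :=
  LinearMap.toContinuousLinearMap
    { toFun := fun x => !₂[x 1, x 2]
      map_add' := fun x y => by ext i; fin_cases i <;> simp
      map_smul' := fun c x => by ext i; fin_cases i <;> simp }

/-- The point `(a, w)` of `ℝ × ℝ² = ℝ³`. -/
def cons (a : ℝ) (w : E2) : E3 := !₂[a, w 0, w 1]

theorem tail_apply (x : E3) : tail x = !₂[x 1, x 2] := rfl

@[simp] theorem cons_zero (a : ℝ) (w : E2) : cons a w 0 = a := rfl

@[simp] theorem tail_cons (a : ℝ) (w : E2) : tail (cons a w) = w := by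
  ext i; fin_cases i <;> rfl

@[simp] theorem cons_tail (x : E3) : cons (x 0) (tail x) = x := by
  ext i; fin_cases i <;> rfl

@[fun_prop]
theorem continuous_cons {X : Type*} [TopologicalSpace X] {f : X → ℝ} {g : X → E2}
    (hf : Continuous f) (hg : Continuous g) : Continuous fun x => cons (f x) (g x) := by
  refine (PiLp.continuous_toLp 2 _).comp (continuous_pi fun i => ?_)
  fin_cases i
  · exact hf
  · exact (EuclideanSpace.proj (𝕜 := ℝ) (0 : Fin 2)).continuous.comp hg
  · exact (EuclideanSpace.proj (𝕜 := ℝ) (1 : Fin 2)).continuous.comp hg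

theorem inner_eq_mul_add_inner_tail (x y : E3) :
    inner ℝ x y = x 0 * y 0 + inner ℝ (tail x) (tail y) := by
  simp [PiLp.inner_apply, Fin.sum_univ_three, Fin.sum_univ_two, tail_apply, mul_comm, add_assoc]

theorem norm_sq_eq_sq_add_norm_tail_sq (x : E3) : ‖x‖ ^ 2 = x 0 ^ 2 + ‖tail x‖ ^ 2 := by
  rw [← real_inner_self_eq_norm_sq, ← real_inner_self_eq_norm_sq, inner_eq_mul_add_inner_tail,
    sq (x 0)]

theorem norm_tail_le (x : E3) : ‖tail x‖ ≤ ‖x‖ := by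
  refine le_of_sq_le_sq ?_ (norm_nonneg x)
  rw [norm_sq_eq_sq_add_norm_tail_sq]
  exact le_add_of_nonneg_left (sq_nonneg _)

theorem norm_cons_le (a : ℝ) (w : E2) : ‖cons a w‖ ≤ |a| + ‖w‖ := by
  refine le_of_sq_le_sq ?_ (by positivity)
  rw [norm_sq_eq_sq_add_norm_tail_sq, cons_zero, tail_cons, ← sq_abs a]
  nlinarith [mul_nonneg (abs_nonneg a) (norm_nonneg w)]

theorem dist_cons_le (a b : ℝ) (w : E2) : dist (cons a w) (cons b w) ≤ |a - b| := by
  have hsub : cons a w - cons b w = cons (a - b) 0 := by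
    ext i; fin_cases i <;> simp [cons]
  rw [dist_eq_norm, hsub]
  simpa using norm_cons_le (a - b) 0

end Coordinates

section BelowGraph

variable {F : E2 → ℝ}

/-- The region `x ≤ -F(y, z)` on and below the graph of `-F`, written as a sublevel set. The
circular cone is the case `F = ‖·‖`, and the asymptotic sets constructed below have this form. -/
def belowGraph (F : E2 → ℝ) : Set E3 := {x | x 0 + F (tail x) ≤ 0}

theorem mem_belowGraph {x : E3} : x ∈ belowGraph F ↔ x 0 + F (tail x) ≤ 0 := Iff.rfl

theorem belowGraph_eq_preimage : belowGraph F = (fun x => x 0 + F (tail x)) ⁻¹' Set.Iic 0 := rfl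

theorem cons_neg_mem_belowGraph (F : E2 → ℝ) (w : E2) : cons (-F w) w ∈ belowGraph F := by
  simp [mem_belowGraph]

theorem circularCone_eq_belowGraph : circularCone = belowGraph fun w => ‖w‖ := by
  ext x
  rw [mem_belowGraph, EuclideanSpace.norm_eq, Fin.sum_univ_two, ← le_neg_iff_add_nonpos_right]
  simp [circularCone, tail_apply]

theorem continuous_zero_add_comp_tail (hF : Continuous F) :
    Continuous fun x : E3 => x 0 + F (tail x) := by
  fun_prop

theorem isOpenMap_zero_add_comp_tail (F : E2 → ℝ) :
    IsOpenMap fun x : E3 => x 0 + F (tail x) :=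
  IsOpenMap.of_sections fun x =>
    ⟨fun t => cons (t - F (tail x)) (tail x), by fun_prop, by simp, fun t => by simp⟩

theorem isClosed_belowGraph (hF : Continuous F) : IsClosed (belowGraph F) :=
  isClosed_Iic.preimage (continuous_zero_add_comp_tail hF)

theorem interior_belowGraph (hF : Continuous F) :
    interior (belowGraph F) = {x | x 0 + F (tail x) < 0} := by
  have h := (isOpenMap_zero_add_comp_tail F).preimage_interior_eq_interior_preimage
    (continuous_zero_add_comp_tail hF) (Set.Iic 0)
  rw [belowGraph_eq_preimage, ← h, interior_Iic]
  rfl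

theorem frontier_belowGraph (hF : Continuous F) :
    frontier (belowGraph F) = {x | x 0 + F (tail x) = 0} := by
  have h := (isOpenMap_zero_add_comp_tail F).preimage_frontier_eq_frontier_preimage
    (continuous_zero_add_comp_tail hF) (Set.Iic 0)
  rw [belowGraph_eq_preimage, ← h, frontier_Iic]
  rfl

theorem cons_neg_mem_frontier_belowGraph (hF : Continuous F) (w : E2) :
    cons (-F w) w ∈ frontier (belowGraph F) := by
  simp [frontier_belowGraph hF]

theorem convex_belowGraph (hF : ConvexOn ℝ Set.univ F) : Convex ℝ (belowGraph F) := by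
  have hcoord : ConvexOn ℝ Set.univ fun x : E3 => x 0 :=
    (EuclideanSpace.proj (𝕜 := ℝ) (0 : Fin 3)).toLinearMap.convexOn convex_univ
  simpa [belowGraph] using (hcoord.add (hF.comp_linearMap tail.toLinearMap)).convex_le 0

theorem belowGraph_subset_circularCone (hle : ∀ w, ‖w‖ ≤ F w) :
    belowGraph F ⊆ circularCone := by
  rw [circularCone_eq_belowGraph]
  exact fun x hx => (add_le_add_right (hle _) _).trans hx

theorem add_smul_mem_belowGraph (hlip : LipschitzWith 1 F) {x y : E3} (hx : x ∈ belowGraph F)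
    (hy : y ∈ circularCone) {l : ℝ} (hl : 0 ≤ l) : x + l • y ∈ belowGraph F := by
  rw [circularCone_eq_belowGraph, mem_belowGraph] at hy
  rw [mem_belowGraph] at hx ⊢
  have hstep : F (tail x + l • tail y) ≤ F (tail x) + l * ‖tail y‖ := by
    simpa [norm_smul, abs_of_nonneg hl] using hlip.le_add_mul (tail x + l • tail y) (tail x)
  calc (x + l • y) 0 + F (tail (x + l • y))
      ≤ (x 0 + F (tail x)) + l * (y 0 + ‖tail y‖) := by
        simp only [PiLp.add_apply, PiLp.smul_apply, smul_eq_mul, map_add, map_smul]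
        linarith
    _ ≤ 0 := add_nonpos hx (mul_nonpos_of_nonneg_of_nonpos hl hy)

theorem recCone_belowGraph_subset (hle : ∀ w, ‖w‖ ≤ F w) :
    recCone (belowGraph F) ⊆ circularCone := by
  intro y hy
  rw [circularCone_eq_belowGraph, mem_belowGraph]
  by_contra! hpos
  have hF0 : 0 ≤ F 0 := (norm_nonneg 0).trans (hle 0)
  set l := F 0 / (y 0 + ‖tail y‖) + 1 with hl
  have hl1 : 1 ≤ l := le_add_of_nonneg_left (by positivity)
  have hmem := hy _ (cons_neg_mem_belowGraph F 0) l hl1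
  have hray : l * ‖tail y‖ ≤ F (l • tail y) := by
    simpa [norm_smul, abs_of_nonneg (zero_le_one.trans hl1)] using hle (l • tail y)
  have hexceeds : F 0 < l * (y 0 + ‖tail y‖) := by
    rw [hl, add_mul, div_mul_cancel₀ _ hpos.ne']
    linarith
  simp only [mem_belowGraph, PiLp.add_apply, PiLp.smul_apply, smul_eq_mul, map_add, map_smul,
    cons_zero, tail_cons, zero_add] at hmem
  linarith

theorem recCone_belowGraph (hlip : LipschitzWith 1 F) (hle : ∀ w, ‖w‖ ≤ F w) :
    recCone (belowGraph F) = circularCone :=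
  (recCone_belowGraph_subset hle).antisymm fun _ hy _ hx _ hl =>
    add_smul_mem_belowGraph hlip hx hy (zero_le_one.trans hl)

theorem isPseudoCone_belowGraph (hconv : ConvexOn ℝ Set.univ F) (hlip : LipschitzWith 1 F)
    (hle : ∀ w, ‖w‖ ≤ F w) : IsPseudoCone (belowGraph F) where
  nonempty := ⟨_, cons_neg_mem_belowGraph F 0⟩
  isClosed := isClosed_belowGraph hlip.continuous
  convex := convex_belowGraph hconv
  smul_mem x hx l hl := by
    have hsplit : l • x = x + (l - 1) • x := by module
    rw [hsplit]
    exact add_smul_mem_belowGraph hlip hx (belowGraph_subset_circularCone hle hx)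
      (sub_nonneg.2 hl)

theorem infDist_frontier_circularCone_le (a : ℝ) (w : E2) :
    Metric.infDist (cons a w) (frontier circularCone) ≤ |a + ‖w‖| := by
  have hmem : cons (-‖w‖) w ∈ frontier circularCone := by
    rw [circularCone_eq_belowGraph]
    exact cons_neg_mem_frontier_belowGraph continuous_norm w
  simpa using (Metric.infDist_le_dist_of_mem hmem).trans (dist_cons_le a (-‖w‖) w)

theorem isCAsymptotic_belowGraph (hconv : ConvexOn ℝ Set.univ F) (hlip : LipschitzWith 1 F)
    (hle : ∀ w, ‖w‖ ≤ F w)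
    (hlim : Tendsto (fun w => F w - ‖w‖) (cocompact E2) (𝓝 0)) :
    IsCAsymptotic circularCone (belowGraph F) := by
  refine ⟨⟨isPseudoCone_belowGraph hconv hlip hle, recCone_belowGraph hlip hle⟩, fun ε hε => ?_⟩
  obtain ⟨S, hS, hgap⟩ := mem_cocompact.1 (hlim.eventually (gt_mem_nhds hε))
  have hF := hlip.continuous
  obtain ⟨R, hR⟩ := hS.exists_bound_of_continuousOn
    (f := fun w => cons (-F w) w) (by fun_prop)
  refine ⟨R, fun x hx hxR => ?_⟩
  obtain ⟨w, rfl⟩ : ∃ w, x = cons (-F w) w := by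
    rw [frontier_belowGraph hF] at hx
    exact ⟨tail x, by rw [← eq_neg_of_add_eq_zero_left hx, cons_tail]⟩
  have hw : F w - ‖w‖ < ε := hgap fun hwS => hxR.not_ge (hR w hwS)
  calc Metric.infDist (cons (-F w) w) (frontier circularCone)
      ≤ |-F w + ‖w‖| := infDist_frontier_circularCone_le _ _
    _ = F w - ‖w‖ := by rw [neg_add_eq_sub, abs_sub_comm, abs_of_nonneg (sub_nonneg.2 (hle w))]
    _ < ε := hw

end BelowGraph

section PolarCone

theorem polarCone_circularCone : polarCone circularCone = -circularCone := by
  ext v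
  rw [circularCone_eq_belowGraph, Set.mem_neg, mem_belowGraph]
  simp only [PiLp.neg_apply, map_neg, norm_neg]
  constructor
  · intro h
    have hdiag := h (cons (-‖tail v‖) (tail v)) (cons_neg_mem_belowGraph _ _)
    have haxis := h (cons (-1) 0) (by simp [mem_belowGraph])
    rw [inner_eq_mul_add_inner_tail] at hdiag haxis
    simp only [cons_zero, tail_cons, real_inner_self_eq_norm_sq, inner_zero_left] at hdiag haxis
    by_contra! hlt
    nlinarith
  · intro hv x hx
    rw [mem_belowGraph] at hx
    rw [inner_eq_mul_add_inner_tail]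
    have hcs := real_inner_le_norm (tail x) (tail v)
    nlinarith [norm_nonneg (tail x), norm_nonneg (tail v)]

theorem mem_Omega_circularCone {v : E3} :
    v ∈ Omega circularCone ↔ ‖tail v‖ < v 0 ∧ ‖v‖ = 1 := by
  have hint : interior (polarCone circularCone) = -interior circularCone := by
    rw [polarCone_circularCone]
    exact ((Homeomorph.neg E3).preimage_interior _).symm
  rw [Omega, hint, circularCone_eq_belowGraph, interior_belowGraph continuous_norm]
  simp

theorem bdryOmega_nonempty {C : Set E3} (hΩ : (Omega C).Nonempty)
    (hΩc : (Metric.sphere 0 1 \ Omega C).Nonempty) : (bdryOmega C).Nonempty := by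
  have hsphere : IsPreconnected (Metric.sphere (0 : E3) 1) :=
    isPreconnected_sphere (by simp [← Module.finrank_eq_rank]) 0 1
  have hcover :
      Metric.sphere (0 : E3) 1 ⊆ closure (Omega C) ∪ closure (Metric.sphere 0 1 \ Omega C) := by
    rw [← closure_union]
    intro v hv
    by_cases hvΩ : v ∈ Omega C
    · exact subset_closure (Or.inl hvΩ)
    · exact subset_closure (Or.inr ⟨hv, hvΩ⟩)
  obtain ⟨v, hv⟩ := hΩ
  obtain ⟨u, hu⟩ := hΩc
  exact (isPreconnected_closed_iff.1 hsphere _ _ isClosed_closure isClosed_closure hcover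
    ⟨v, hv.2, subset_closure hv⟩ ⟨u, hu.1, subset_closure hu⟩).mono Set.inter_subset_right

theorem bdryOmega_circularCone_nonempty : (bdryOmega circularCone).Nonempty := by
  have hnorm : ‖cons 1 0‖ = 1 := by
    rw [← sq_eq_sq₀ (norm_nonneg _) zero_le_one, norm_sq_eq_sq_add_norm_tail_sq]
    simp
  refine bdryOmega_nonempty ⟨cons 1 0, mem_Omega_circularCone.2 ⟨by simp, hnorm⟩⟩
    ⟨-cons 1 0, by simpa using hnorm, fun h => ?_⟩
  have := (mem_Omega_circularCone.1 h).1
  norm_num at this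

theorem bdryOmega_subset_sphere (C : Set E3) : bdryOmega C ⊆ Metric.sphere 0 1 :=
  fun _ hw => closure_minimal Set.sdiff_subset Metric.isClosed_sphere hw.2

theorem le_norm_tail_of_mem_bdryOmega {w : E3} (hw : w ∈ bdryOmega circularCone) :
    w 0 ≤ ‖tail w‖ := by
  refine closure_minimal (s := Metric.sphere 0 1 \ Omega circularCone)
    (t := {w : E3 | w 0 ≤ ‖tail w‖}) (fun u hu => ?_) (isClosed_le (by fun_prop) (by fun_prop)) hw.2
  by_contra! hlt
  exact hu.2 (mem_Omega_circularCone.2 ⟨not_le.1 hlt, by simpa using hu.1⟩)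

theorem norm_sub_le_angle {V : Type*} [NormedAddCommGroup V] [InnerProductSpace ℝ V] {v w : V}
    (hv : ‖v‖ = 1) (hw : ‖w‖ = 1) : ‖v - w‖ ≤ InnerProductGeometry.angle v w := by
  refine le_of_sq_le_sq ?_ (InnerProductGeometry.angle_nonneg v w)
  have hcos := Real.one_sub_sq_div_two_le_cos (x := InnerProductGeometry.angle v w)
  have hinner := InnerProductGeometry.cos_angle_mul_norm_mul_norm v w
  rw [hv, hw, mul_one, mul_one] at hinner
  rw [norm_sub_sq_real, hv, hw]
  linarith

theorem div_two_le_sphDist {v : E3} (hv : ‖v‖ = 1) :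
    (v 0 - ‖tail v‖) / 2 ≤ sphDist circularCone v := by
  refine le_csInf (bdryOmega_circularCone_nonempty.image _) ?_
  rintro _ ⟨w, hw, rfl⟩
  have hw0 := le_norm_tail_of_mem_bdryOmega hw
  have hcoord : v 0 - w 0 ≤ ‖v - w‖ := (le_abs_self _).trans (PiLp.norm_apply_le (v - w) 0)
  have htail : ‖tail w‖ - ‖tail v‖ ≤ ‖v - w‖ := by
    rw [norm_sub_rev]
    exact (norm_sub_norm_le _ _).trans (by rw [← map_sub]; exact norm_tail_le _)
  calc (v 0 - ‖tail v‖) / 2 ≤ ‖v - w‖ := by linarith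
    _ ≤ InnerProductGeometry.angle v w :=
        norm_sub_le_angle hv (by simpa using bdryOmega_subset_sphere _ hw)

theorem normalize_cons_one_mem_omega {k : E2} {α : ℝ} (hα : 0 ≤ α) (hk : 4 * α < 1 - ‖k‖) :
    NormedSpace.normalize (cons 1 k) ∈ omega circularCone α := by
  have hne : cons 1 k ≠ 0 := fun h => one_ne_zero (congrArg (fun x : E3 => x 0) h)
  have hN : 0 < ‖cons 1 k‖ := norm_pos_iff.2 hne
  have hN2 : ‖cons 1 k‖ ≤ 2 := by
    have := norm_cons_le 1 k
    rw [abs_one] at this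
    linarith
  have hnorm : ‖NormedSpace.normalize (cons 1 k)‖ = 1 := NormedSpace.norm_normalize hne
  have hgap : 2 * α < NormedSpace.normalize (cons 1 k) 0
      - ‖tail (NormedSpace.normalize (cons 1 k))‖ := by
    have : 2 * α < (1 - ‖k‖) / ‖cons 1 k‖ := by
      rw [lt_div_iff₀ hN]
      nlinarith
    simpa [NormedSpace.normalize, norm_smul, sub_div, div_eq_inv_mul, mul_sub] using this
  refine ⟨mem_Omega_circularCone.2 ⟨by linarith, hnorm⟩, ?_⟩
  exact lt_of_lt_of_le (by linarith) (div_two_le_sphDist hnorm)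

end PolarCone

section SurfaceArea

variable {F : E2 → ℝ}

theorem inner_cons_one_le_of_mem_belowGraph {x : E3} (hx : x ∈ belowGraph F) {k w : E2}
    (hk : IsSubgradientAt F k w) : inner ℝ x (cons 1 k) ≤ inner ℝ (cons (-F w) w) (cons 1 k) := by
  rw [mem_belowGraph] at hx
  have hsub := hk (tail x)
  rw [inner_sub_right, real_inner_comm, real_inner_comm w k] at hsub
  simp only [inner_eq_mul_add_inner_tail, cons_zero, tail_cons, mul_one]
  linarith

theorem cons_neg_mem_invGauss_belowGraph (hF : Continuous F) {η : Set E3} {k w : E2}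
    (hk : IsSubgradientAt F k w) (hη : NormedSpace.normalize (cons 1 k) ∈ η) :
    cons (-F w) w ∈ invGauss (belowGraph F) η := by
  have hmax : IsGreatest ((fun x => inner ℝ x (NormedSpace.normalize (cons 1 k))) '' belowGraph F)
      (inner ℝ (cons (-F w) w) (NormedSpace.normalize (cons 1 k))) := by
    refine ⟨Set.mem_image_of_mem _ (cons_neg_mem_belowGraph F w), ?_⟩
    rintro _ ⟨x, hx, rfl⟩
    simp only [NormedSpace.normalize, real_inner_smul_right]
    gcongr
    exact inner_cons_one_le_of_mem_belowGraph hx hk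
  exact ⟨cons_neg_mem_frontier_belowGraph hF w, _, hη, hmax.csSup_eq.symm⟩

theorem volume_tail_image_le (s : Set E3) : volume (tail '' s) ≤ μHE[2] s := by
  rw [← EuclideanSpace.euclideanHausdorffMeasure_eq_volume 2,
    Measure.euclideanHausdorffMeasure_def, Measure.euclideanHausdorffMeasure_def,
    Measure.smul_apply, Measure.smul_apply]
  have hlip : LipschitzWith 1 tail := LipschitzWith.of_dist_le_mul fun x y => by
    simpa [dist_eq_norm] using norm_tail_le (x - y)
  gcongr
  simpa using hlip.hausdorffMeasure_image_le (d := ((2 : ℕ) : ℝ)) (by positivity) s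

theorem volume_le_surfaceArea_belowGraph (hF : Continuous F) {α : ℝ} (hα : 0 ≤ α) {A : Set E2}
    (hA : ∀ w ∈ A, ∃ k, IsSubgradientAt F k w ∧ 4 * α < 1 - ‖k‖) :
    volume A ≤ surfaceArea (belowGraph F) (omega circularCone α) := by
  have hsub : A ⊆ tail '' invGauss (belowGraph F) (omega circularCone α) := by
    intro w hw
    obtain ⟨k, hk, hkα⟩ := hA w hw
    exact ⟨cons (-F w) w,
      cons_neg_mem_invGauss_belowGraph hF hk (normalize_cons_one_mem_omega hα hkα), tail_cons _ _⟩
  exact (measure_mono hsub).trans (volume_tail_image_le _)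

end SurfaceArea

section Profile

variable {q r t : ℝ}

theorem one_add_mul_self_le_rpow_one_add_of_nonpos {s p : ℝ} (hs : -1 < s) (hp : p ≤ 0) :
    1 + p * s ≤ (1 + s) ^ p := by
  have hpos : 0 < 1 + s := by linarith
  have hlog : Real.log (1 + s) ≤ s := by linarith [Real.log_le_sub_one_of_pos hpos]
  calc 1 + p * s ≤ Real.log (1 + s) * p + 1 := by linarith [mul_le_mul_of_nonpos_left hlog hp]
    _ ≤ Real.exp (Real.log (1 + s) * p) := Real.add_one_le_exp _
    _ = (1 + s) ^ p := (Real.rpow_def_of_pos hpos p).symm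

theorem rpow_add_mul_sub_le_rpow_of_nonpos {a b p : ℝ} (ha : 0 < a) (hb : 0 < b) (hp : p ≤ 0) :
    a ^ p + p * a ^ (p - 1) * (b - a) ≤ b ^ p := by
  have hbern := one_add_mul_self_le_rpow_one_add_of_nonpos (s := b / a - 1)
    (by linarith [div_pos hb ha]) hp
  calc a ^ p + p * a ^ (p - 1) * (b - a) = a ^ p * (1 + p * (b / a - 1)) := by
        rw [Real.rpow_sub_one ha.ne']
        field_simp
    _ ≤ a ^ p * (b / a) ^ p := by
        rw [add_sub_cancel] at hbern
        gcongr
    _ = b ^ p := by rw [← Real.mul_rpow ha.le (by positivity), mul_div_cancel₀ _ ha.ne']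

/-- The height of the radial profile above its asymptote `r ↦ r`; the constant makes
`-(1 + r) ^ (-q)` its derivative. -/
def profileGap (q r : ℝ) : ℝ := (1 + r) ^ (1 - q) / (q - 1)

/-- The convex function of the radius whose graph is rotated to give the asymptotic set. -/
def profile (q r : ℝ) : ℝ := r + profileGap q r

theorem profileGap_nonneg (hq : 1 < q) (hr : 0 ≤ r) : 0 ≤ profileGap q r :=
  div_nonneg (Real.rpow_nonneg (by linarith) _) (by linarith)

theorem tendsto_profileGap_atTop (hq : 1 < q) : Tendsto (profileGap q) atTop (𝓝 0) := by
  have h := ((tendsto_rpow_neg_atTop (sub_pos.2 hq)).comp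
    (tendsto_atTop_add_const_left atTop 1 tendsto_id)).div_const (q - 1)
  rw [zero_div] at h
  exact h.congr fun r => by simp [profileGap]

theorem profile_add_mul_sub_le_profile (hq : 1 < q) (hr : 0 ≤ r) (ht : 0 ≤ t) :
    profile q r + (1 - (1 + r) ^ (-q)) * (t - r) ≤ profile q t := by
  have hq' : 0 < q - 1 := sub_pos.2 hq
  have hpow := rpow_add_mul_sub_le_rpow_of_nonpos (a := 1 + r) (b := 1 + t) (p := 1 - q)
    (by linarith) (by linarith) (by linarith)
  rw [sub_sub_cancel_left, add_sub_add_left_eq_sub] at hpow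
  have hgap : profileGap q r - (1 + r) ^ (-q) * (t - r) ≤ profileGap q t := by
    rw [profileGap, profileGap, div_sub' hq'.ne']
    gcongr
    linarith
  unfold profile
  linarith

variable {V : Type*} [NormedAddCommGroup V] [InnerProductSpace ℝ V]

theorem exists_isSubgradientAt_profile_norm (hq : 1 < q) (w : V) :
    ∃ k, IsSubgradientAt (fun u => profile q ‖u‖) k w ∧ ‖k‖ ≤ 1 - (1 + ‖w‖) ^ (-q) := by
  have hw := norm_nonneg w
  refine exists_isSubgradientAt_comp_norm (φ := profile q) (sub_nonneg.2 ?_) w fun t ht =>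
    profile_add_mul_sub_le_profile hq hw ht
  exact Real.rpow_le_one_of_one_le_of_nonpos (by linarith) (by linarith)

theorem convexOn_profile_norm (hq : 1 < q) :
    ConvexOn ℝ Set.univ fun w : V => profile q ‖w‖ :=
  convexOn_univ_of_isSubgradientAt fun w =>
    (exists_isSubgradientAt_profile_norm hq w).imp fun _ hk => hk.1

theorem lipschitzWith_profile_norm (hq : 1 < q) :
    LipschitzWith 1 fun w : V => profile q ‖w‖ := by
  refine lipschitzWith_of_isSubgradientAt fun w => ?_
  obtain ⟨k, hk, hk1⟩ := exists_isSubgradientAt_profile_norm hq w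
  have hpos : 0 ≤ (1 + ‖w‖) ^ (-q) := by positivity
  exact ⟨k, hk, by rw [NNReal.coe_one]; linarith⟩

/-- The asymptotic set obtained by rotating the profile about the axis of the circular cone. -/
def profileBody (q : ℝ) : Set E3 := belowGraph fun w => profile q ‖w‖

theorem isCAsymptotic_profileBody (hq : 1 < q) : IsCAsymptotic circularCone (profileBody q) := by
  refine isCAsymptotic_belowGraph (convexOn_profile_norm hq) (lipschitzWith_profile_norm hq)
    (fun w => le_add_of_nonneg_right (profileGap_nonneg hq (norm_nonneg w))) ?_
  simpa [profile, Function.comp_def] using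
    (tendsto_profileGap_atTop hq).comp (tendsto_norm_cocompact_atTop (E := E2))

theorem volume_ball_le_surfaceArea_profileBody (hq : 1 < q) {α ρ : ℝ} (hα : 0 ≤ α)
    (hρ : 4 * α ≤ (1 + ρ) ^ (-q)) :
    volume (Metric.ball (0 : E2) ρ) ≤ surfaceArea (profileBody q) (omega circularCone α) := by
  refine volume_le_surfaceArea_belowGraph (lipschitzWith_profile_norm hq).continuous hα
    fun w hw => ?_
  obtain ⟨k, hk, hk1⟩ := exists_isSubgradientAt_profile_norm hq w
  have hw' : ‖w‖ < ρ := mem_ball_zero_iff.1 hw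
  have hpow : (1 + ρ) ^ (-q) < (1 + ‖w‖) ^ (-q) :=
    Real.rpow_lt_rpow_of_neg (by positivity) (by linarith) (by linarith)
  exact ⟨k, hk, by linarith⟩

end Profile

section Integral

theorem ofReal_sq_le_volume_ball (w : E2) (ρ : ℝ) :
    ENNReal.ofReal ρ ^ 2 ≤ volume (Metric.ball w ρ) := by
  rw [EuclideanSpace.volume_ball_fin_two]
  refine le_mul_of_one_le_right' ?_
  rw [← ENNReal.ofReal_one]
  exact ENNReal.ofReal_le_ofReal (by linarith [Real.pi_gt_three])

theorem lintegral_Ioo_ofReal_div_eq_top {a c : ℝ} (ha : 0 < a) (hc : 0 < c) :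
    ∫⁻ x in Set.Ioo 0 a, ENNReal.ofReal (c / x) = ⊤ := by
  by_contra hfin
  have hint : IntegrableOn (fun x => c / x) (Set.Ioo 0 a) := by
    refine (lintegral_ofReal_ne_top_iff_integrable (by fun_prop) ?_).1 hfin
    filter_upwards [ae_restrict_mem measurableSet_Ioo] with x hx
    exact (div_pos hc hx.1).le
  have hrpow : IntegrableOn (fun x : ℝ => x ^ (-1 : ℝ)) (Set.Ioo 0 a) := by
    refine (hint.const_mul c⁻¹).congr (Eventually.of_forall fun x => ?_)
    simp [div_eq_mul_inv, Real.rpow_neg_one, hc.ne']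
  exact lt_irrefl _ ((intervalIntegral.integrableOn_Ioo_rpow_iff ha).1 hrpow)

theorem J_eq_top_of_div_le {C : Set E3} {m a c : ℝ} {μ : Set E3 → ℝ≥0∞} (ha : 0 < a)
    (ha' : a ≤ Real.pi / 2) (hc : 0 < c)
    (h : ∀ α ∈ Set.Ioo 0 a, ENNReal.ofReal (c / α) ≤ μ (omega C α) ^ (1 / m)) :
    J C m μ = ⊤ := by
  rw [← top_le_iff, ← lintegral_Ioo_ofReal_div_eq_top ha hc]
  exact (setLIntegral_mono' measurableSet_Ioo h).trans
    (lintegral_mono_set (Set.Ioo_subset_Ioo_right ha'))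

theorem J_lt_top_of_le {C : Set E3} {m n : ℝ} (hm : 0 < m) (hmn : m ≤ n)
    {μ : Set E3 → ℝ≥0∞} (h : J C m μ < ⊤) : J C n μ < ⊤ := by
  have hpow : ∀ x : ℝ≥0∞, x ^ (1 / n) ≤ 1 + x ^ (1 / m) := by
    intro x
    rcases le_total x 1 with hx | hx
    · exact le_add_right (ENNReal.rpow_le_one hx (one_div_nonneg.2 (hm.le.trans hmn)))
    · exact le_add_left
        (ENNReal.rpow_le_rpow_of_exponent_le hx (one_div_le_one_div_of_le hm hmn))
  calc J C n μ ≤ ∫⁻ α in Set.Ioo (0 : ℝ) (Real.pi / 2), (1 + μ (omega C α) ^ (1 / m)) :=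
        lintegral_mono fun α => hpow _
    _ = volume (Set.Ioo (0 : ℝ) (Real.pi / 2)) + J C m μ := by
        rw [lintegral_add_left measurable_const, setLIntegral_one, J]
    _ < ⊤ := ENNReal.add_lt_top.2 ⟨by simp, h⟩

theorem ofReal_div_le_surfaceArea_profileBody_rpow {q α : ℝ} (hq : 1 < q) (hα : 0 < α)
    (hαq : α ≤ 2 ^ (-q) / 4) :
    ENNReal.ofReal (2 ^ (-q) / 4 / α) ≤
      surfaceArea (profileBody q) (omega circularCone α) ^ (q / 2) := by
  have hq0 : 0 < q := zero_lt_one.trans hq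
  set c : ℝ := 2 ^ (-q) / 4 with hc
  set ρ : ℝ := (c / α) ^ q⁻¹
  have hρ1 : 1 ≤ ρ := Real.one_le_rpow ((one_le_div hα).2 hαq) (by positivity)
  have hρq : ρ ^ q = c / α := Real.rpow_inv_rpow (by positivity) hq0.ne'
  have hradius : 4 * α ≤ (1 + ρ) ^ (-q) := calc
    4 * α = (2 * ρ) ^ (-q) := by
      rw [Real.mul_rpow (by norm_num) (by positivity), Real.rpow_neg (x := ρ) (by positivity), hρq,
        inv_div, hc]
      field_simp
    _ ≤ (1 + ρ) ^ (-q) :=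
      Real.rpow_le_rpow_of_nonpos (by positivity) (by linarith) (by linarith)
  calc ENNReal.ofReal (c / α) = (ENNReal.ofReal ρ ^ 2) ^ (q / 2) := by
        rw [← ENNReal.rpow_natCast, ← ENNReal.rpow_mul, Nat.cast_ofNat,
          mul_div_cancel₀ _ two_ne_zero, ENNReal.ofReal_rpow_of_nonneg (by positivity) hq0.le, hρq]
    _ ≤ surfaceArea (profileBody q) (omega circularCone α) ^ (q / 2) := by
        gcongr
        exact (ofReal_sq_le_volume_ball 0 ρ).trans
          (volume_ball_le_surfaceArea_profileBody hq hα.le hradius)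

theorem J_surfaceArea_profileBody {q : ℝ} (hq : 1 < q) :
    J circularCone (2 / q) (surfaceArea (profileBody q)) = ⊤ := by
  have hc1 : (2 : ℝ) ^ (-q) ≤ 1 :=
    Real.rpow_le_one_of_one_le_of_nonpos one_le_two (by linarith)
  refine J_eq_top_of_div_le (a := 2 ^ (-q) / 4) (c := 2 ^ (-q) / 4) (by positivity)
    (by linarith [Real.pi_gt_three]) (by positivity) fun α hα => ?_
  rw [one_div_div]
  exact ofReal_div_le_surfaceArea_profileBody_rpow hq hα.1 hα.2.le

end Integral

end

end PseudoCone

theorem proposition4p6 (m : ℝ) (hm0 : 0 < m) (hm2 : m < 2) :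
    (∃ K : Set PseudoCone.E3,
      PseudoCone.IsCAsymptotic PseudoCone.circularCone K ∧
      PseudoCone.J PseudoCone.circularCone m (PseudoCone.surfaceArea K) = ⊤) ∧
    (∀ μ : MeasureTheory.Measure PseudoCone.E3,
      PseudoCone.J PseudoCone.circularCone m (fun η => μ η) < ⊤ →
      PseudoCone.J PseudoCone.circularCone 2 (fun η => μ η) < ⊤) ∧
    ¬ (∀ K : Set PseudoCone.E3,
      PseudoCone.IsCAsymptotic PseudoCone.circularCone K →
      PseudoCone.J PseudoCone.circularCone m (PseudoCone.surfaceArea K) < ⊤) := by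
  have hq : 1 < 2 / m := (one_lt_div hm0).2 hm2
  have hK := PseudoCone.isCAsymptotic_profileBody hq
  have hJ := PseudoCone.J_surfaceArea_profileBody hq
  rw [div_div_cancel₀ two_ne_zero] at hJ
  exact ⟨⟨_, hK, hJ⟩, fun μ h => PseudoCone.J_lt_top_of_le hm0 hm2.le h,
    fun h => (h _ hK).ne hJ⟩
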